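/- Let $n,k,\ell\ge 0$ be integers, and let $y=(y_\alpha)_{\alpha\in\mathbb N^n,\,|\alpha|\le 2k}$ be a real vector (a truncated moment sequence of degree $2k$), with Riesz functional $\mathscr L_y\big(\sum_\alpha p_\alpha x^\alpha\big)=\sum_\alpha p_\alpha y_\alpha$ on the real polynomials in $x=(x_1,\dots,x_n)$ of degree at most $2k$. Let $H=(H_{ij})$ be a symmetric $\ell\times\ell$ matrix with entries in $\mathbb R[x]$, and put $D=\max_{i,j}\deg(H_{ij})$ (with $D=0$ if $\ell=0$, and $\deg 0=0$) and $d_H=\max_{i,j}\{1,\lceil \deg(H_{ij})/2\rceil\}$. For $0\le t\le k$ let $M_t(y)=\big(\mathscr L_y(x^{\alpha}x^{\beta})\big)_{|\alpha|,|\beta|\le t}$ be the $t$-th moment matrix. Let $L_H^{(k)}(y)$ be the block matrix whose $(i,j)$ block, $1\le i,j\le\ell$, is $\big(\mathscr L_y(H_{ij}\,x^{\alpha}x^{\beta})\big)_{\alpha,\beta}$, where $\alpha,\beta$ run over all exponents in $\mathbb N^n$ with $2|\alpha|+D\le 2k$ and $2|\beta|+D\le 2k$. Suppose that $y$ is flat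 with respect to $H\succeq 0$, that is, $d_H\le k$ and $$M_k(y)\succeq 0,\qquad L_H^{(k)}(y)\succeq 0,\qquad \operatorname{rank} M_{k-d_H}(y)=\operatorname{rank} M_k(y).$$ Then there is exactly one Borel measure $\mu$ on $\mathbb R^n$ representing $y$, i.e. such that every monomial $x^\alpha$ with $|\alpha|\le 2k$ is $\mu$-integrable and $y_\alpha=\int x^\alpha\,d\mu$. Moreover, this $\mu$ is $\operatorname{rank}M_k(y)$-atomic, i.e. its support consists of exactly $\operatorname{rank}M_k(y)$ distinct points, and its support is contained in $\{x\in\mathbb R^n: H(x)\succeq 0\}$. -/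

import Mathlib

open MeasureTheory

/-- `ℕ^n_d`: the exponents `α ∈ ℕ^n` with `|α| = α_1 + ⋯ + α_n ≤ d`. -/
abbrev Expo (n d : ℕ) : Type := {α : Fin n →₀ ℕ // α.degree ≤ d}

/-- The exponents `α ∈ ℕ^n` with `2|α| + e ≤ 2k`: the row and column labels of the `k`-th localizing
matrix of a polynomial of degree `e`. -/
abbrev LocExpo (n k e : ℕ) : Type := {α : Fin n →₀ ℕ // 2 * α.degree + e ≤ 2 * k}

instance Expo.instFinite (n d : ℕ) : Finite (Expo n d) :=
  (Finsupp.finite_of_degree_le d).to_subtype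

instance LocExpo.instFinite (n k e : ℕ) : Finite (LocExpo n k e) :=
  ((Finsupp.finite_of_degree_le (σ := Fin n) k).subset
    (fun α (h : 2 * α.degree + e ≤ 2 * k) => show α.degree ≤ k by omega)).to_subtype

noncomputable instance Expo.instFintype (n d : ℕ) : Fintype (Expo n d) := Fintype.ofFinite _

noncomputable instance LocExpo.instFintype (n k e : ℕ) : Fintype (LocExpo n k e) :=
  Fintype.ofFinite _

/-- A truncated moment sequence in `n` variables of degree `d`: a real vector indexed by `ℕ^n_d`. -/
abbrev TMS (n d : ℕ) : Type := Expo n d → ℝ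

/-- The Riesz functional `∑ p_α x^α ↦ ∑ p_α y_α` of `y`. It is only meant for polynomials `p` of
degree at most `d`, and only applied to such below. -/
noncomputable def riesz {n d : ℕ} (y : TMS n d) (p : MvPolynomial (Fin n) ℝ) : ℝ :=
  ∑ α : Expo n d, p.coeff α.1 * y α

/-- The matrix with the entries `𝓛_y(q x^α x^β)`, where `α`, `β` run through the exponents with
`2|α| + e, 2|β| + e ≤ 2k`; here `e` is an upper bound of `deg q`. -/
noncomputable def locMatrix {n d : ℕ} (y : TMS n d) (q : MvPolynomial (Fin n) ℝ) (k e : ℕ) :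
    Matrix (LocExpo n k e) (LocExpo n k e) ℝ :=
  Matrix.of fun α β =>
    riesz y (q * MvPolynomial.monomial α.1 1 * MvPolynomial.monomial β.1 1)

/-- The moment matrix `M_k(y)`, the `k`-th localizing matrix of the polynomial `1`. -/
noncomputable def momentMatrix {n d : ℕ} (y : TMS n d) (k : ℕ) :
    Matrix (LocExpo n k 0) (LocExpo n k 0) ℝ :=
  locMatrix y 1 k 0

/-- The largest degree of an entry of `H`. -/
noncomputable def entryDegree {n l : ℕ} (H : Matrix (Fin l) (Fin l) (MvPolynomial (Fin n) ℝ)) : ℕ :=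
  Finset.univ.sup fun ij : Fin l × Fin l => (H ij.1 ij.2).totalDegree

/-- `d_H = max_{i,j} {1, ⌈deg(H_ij)/2⌉}`; the ceiling `⌈m/2⌉` is the natural number `(m + 1) / 2`. -/
noncomputable def halfDegree {n l : ℕ} (H : Matrix (Fin l) (Fin l) (MvPolynomial (Fin n) ℝ)) : ℕ :=
  max 1 (Finset.univ.sup fun ij : Fin l × Fin l => ((H ij.1 ij.2).totalDegree + 1) / 2)

/-- The `k`-th localizing matrix `L_H^{(k)}(y)` of a matrix polynomial `H`: the block matrix whose
`(i, j)` block is the `k`-th localizing matrix of `H_ij`. For the blocks to fit together they all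
carry the common labels `α` with `2|α| + max_{i,j} deg(H_ij) ≤ 2k`. -/
noncomputable def blockLocMatrix {n d l : ℕ} (y : TMS n d)
    (H : Matrix (Fin l) (Fin l) (MvPolynomial (Fin n) ℝ)) (k : ℕ) :
    Matrix (Fin l × LocExpo n k (entryDegree H)) (Fin l × LocExpo n k (entryDegree H)) ℝ :=
  Matrix.of fun a b => locMatrix y (H a.1 b.1) k (entryDegree H) a.2 b.2

/-- `y`, of degree `2k`, is flat with respect to `H ⪰ 0`. The condition `d_H ≤ k` is what makes
`M_{k - d_H}(y)` meaningful. -/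
structure IsFlat {n k l : ℕ} (y : TMS n (2 * k))
    (H : Matrix (Fin l) (Fin l) (MvPolynomial (Fin n) ℝ)) : Prop where
  le : halfDegree H ≤ k
  moment_psd : (momentMatrix y k).PosSemidef
  loc_psd : (blockLocMatrix y H k).PosSemidef
  rank_eq : (momentMatrix y (k - halfDegree H)).rank = (momentMatrix y k).rank

/-- The Borel measure `μ` on `ℝ^n` represents `y`: all the monomials `x^α`, `|α| ≤ d`, are integrable
and `y_α = ∫ x^α dμ`. -/
def IsRepresentingMeasure {n d : ℕ} (y : TMS n d) (μ : Measure (Fin n → ℝ)) : Prop :=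
  ∀ α : Expo n d, Integrable (fun x : Fin n → ℝ => ∏ i, x i ^ α.1 i) μ ∧
    ∫ x, ∏ i, x i ^ α.1 i ∂μ = y α

/-- `μ` is `r`-atomic: its support consists of `r` distinct points. -/
def IsAtomicOfCard {n : ℕ} (μ : Measure (Fin n → ℝ)) (r : ℕ) : Prop :=
  μ.support.encard = r

/-- `{x ∈ ℝ^n : H(x) ⪰ 0}`. -/
def psdSet {n l : ℕ} (H : Matrix (Fin l) (Fin l) (MvPolynomial (Fin n) ℝ)) : Set (Fin n → ℝ) :=
  {x | (H.map (MvPolynomial.eval x)).PosSemidef}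

/-! Factoring M_k(y) ⪰ 0 gives a linear map Φ from polynomials to ℝ^r, r = rank M_k(y), with ⟪Φ p, Φ
q⟫ = 𝓛(pq) in degrees ≤ k (`exists_gram_map`). By the rank condition Φ is already onto from degree ≤
j = k - d_H, and j + 1 ≤ k as d_H ≥ 1. So multiplication by each variable descends to an operator on
ℝ^r; these operators are symmetric and commute (`exists_multiplication_operators`).

Splitting Φ 1 = ∑ v_γ into joint eigenvectors gives Φ p = ∑ p(γ) v_γ (`exists_eval_decomposition`),
hence 𝓛 = ∑ ‖v_γ‖² δ_γ up to degree 2k: a representing measure. The v_γ form an orthogonal basis, so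
there are r atoms.

Choose P_γ of degree ≤ j with Φ P_γ = v_γ; it interpolates the indicator of γ on the atoms. Any
representing measure lives on the zeros of ker Φ in degree ≤ k, hence on the atoms, and gives γ the
mass 𝓛(P_γ): uniqueness. Testing L_H ⪰ 0 on c_i P_γ gives ‖v_γ‖² cᵀH(γ)c ≥ 0. -/

/-! ### Gram matrices and rank -/

theorem rank_gram {ι E : Type*} [Fintype ι] [NormedAddCommGroup E] [InnerProductSpace ℝ E]
    [FiniteDimensional ℝ E] (v : ι → E) :
    (Matrix.gram ℝ v).rank = Module.finrank ℝ (Submodule.span ℝ (Set.range v)) := by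
  let b := stdOrthonormalBasis ℝ E
  let e : E ≃ₗ[ℝ] (Fin (Module.finrank ℝ E) → ℝ) :=
    b.repr.toLinearEquiv.trans (WithLp.linearEquiv 2 ℝ _)
  have h := Matrix.gram_eq_conjTranspose_mul b v
  rw [h, Matrix.rank_conjTranspose_mul_self, Matrix.rank_eq_finrank_span_cols]
  have : Set.range (Matrix.of fun i j => b.repr (v j) i).col
      = (e : E →ₗ[ℝ] _) '' Set.range v := by
    rw [← Set.range_comp]
    rfl
  rw [this, ← Submodule.map_span]
  exact LinearEquiv.finrank_map_eq e _

open scoped InnerProductSpace in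
/-- A positive semidefinite matrix of rank `r` is a Gram matrix of vectors in `ℝ^r`, which are spanned
by those belonging to a principal submatrix of the same rank. -/
theorem Matrix.PosSemidef.exists_gram_rank {ι κ : Type*} [Fintype ι] [Fintype κ]
    {M : Matrix ι ι ℝ} (hM : M.PosSemidef) (f : κ → ι)
    (hf : (M.submatrix f f).rank = M.rank) :
    ∃ u : ι → EuclideanSpace ℝ (Fin M.rank), (∀ i j, ⟪u i, u j⟫_ℝ = M i j) ∧
      Submodule.span ℝ (Set.range (u ∘ f)) = ⊤ := by
  classical
  obtain ⟨A, hA⟩ : ∃ A : Matrix ι ι ℝ, M = A.conjTranspose * A := by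
    open scoped MatrixOrder in
    obtain ⟨A, rfl⟩ := CStarAlgebra.nonneg_iff_eq_star_mul_self.mp hM.nonneg
    exact ⟨A, rfl⟩
  let a : ι → EuclideanSpace ℝ ι := fun i => WithLp.toLp 2 (fun l => A l i)
  have ha : Matrix.gram ℝ a = M := by
    ext i j
    simp [hA, Matrix.gram_apply, Matrix.mul_apply, a, PiLp.inner_apply, mul_comm]
  let W := Submodule.span ℝ (Set.range a)
  have hW : Module.finrank ℝ W = M.rank := by rw [← rank_gram, ha]
  -- Both spans have the rank of a Gram matrix as dimension, and `hf` equates these ranks.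
  have hW' : Submodule.span ℝ (Set.range (a ∘ f)) = W := by
    refine Submodule.eq_of_le_of_finrank_eq
      (Submodule.span_mono (Set.range_comp_subset_range f a)) ?_
    rw [hW, ← rank_gram, ← hf, ← ha]
    rfl
  let e : W ≃ₗᵢ[ℝ] EuclideanSpace ℝ (Fin M.rank) :=
    ((stdOrthonormalBasis ℝ W).reindex (finCongr hW)).repr
  let w : ι → W := fun i => ⟨a i, Submodule.subset_span ⟨i, rfl⟩⟩
  refine ⟨fun i => e (w i), fun i j => ?_, ?_⟩
  · rw [e.inner_map_map, ← ha]
    rfl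
  · have h1 : Submodule.span ℝ (Set.range (w ∘ f)) = ⊤ := by
      apply Submodule.map_injective_of_injective W.injective_subtype
      rw [Submodule.map_span, ← Set.range_comp, Submodule.map_subtype_top]
      exact hW'
    have h2 : Set.range ((fun i => e (w i)) ∘ f)
        = (e.toLinearEquiv : W →ₗ[ℝ] _) '' Set.range (w ∘ f) := by
      rw [← Set.range_comp]
      rfl
    rw [h2, ← Submodule.map_span, h1, Submodule.map_top, LinearEquiv.range]

/-! ### The Riesz functional and integration of polynomials -/

section Riesz

variable {n d : ℕ}

/-- The Riesz functional as a linear map. -/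
noncomputable def rieszLin (y : TMS n d) : MvPolynomial (Fin n) ℝ →ₗ[ℝ] ℝ where
  toFun := riesz y
  map_add' p q := by simp [riesz, add_mul, Finset.sum_add_distrib]
  map_smul' c p := by simp [riesz, mul_assoc, Finset.mul_sum]

theorem rieszLin_apply (y : TMS n d) (p : MvPolynomial (Fin n) ℝ) : rieszLin y p = riesz y p := rfl

theorem riesz_monomial (y : TMS n d) (α : Expo n d) :
    riesz y (MvPolynomial.monomial α.1 1) = y α := by
  classical
  rw [riesz, Finset.sum_eq_single α]
  · simp
  · intro β _ h
    rw [MvPolynomial.coeff_monomial, if_neg (fun h' => h (Subtype.ext h'.symm)), zero_mul]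
  · simp

theorem MvPolynomial.degree_le_of_mem_support {σ R : Type*} [CommSemiring R]
    {p : MvPolynomial σ R} {α : σ →₀ ℕ} (h : α ∈ p.support) : α.degree ≤ p.totalDegree :=
  MvPolynomial.le_totalDegree h

theorem MvPolynomial.totalDegree_monomial_one {σ : Type*} (α : σ →₀ ℕ) :
    (MvPolynomial.monomial α (1 : ℝ)).totalDegree = α.degree :=
  MvPolynomial.totalDegree_monomial _ one_ne_zero

/-- Two linear maps on polynomials agree up to degree `d` if they do on the monomials. -/
theorem MvPolynomial.linearMap_eq_of_totalDegree_le {σ V : Type*} [AddCommGroup V] [Module ℝ V]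
    {f g : MvPolynomial σ ℝ →ₗ[ℝ] V} {d : ℕ}
    (h : ∀ α : σ →₀ ℕ, α.degree ≤ d → f (monomial α 1) = g (monomial α 1))
    {p : MvPolynomial σ ℝ} (hp : p.totalDegree ≤ d) : f p = g p := by
  rw [p.as_sum, map_sum, map_sum]
  refine Finset.sum_congr rfl fun α hα => ?_
  have : monomial α (p.coeff α) = p.coeff α • monomial α (1 : ℝ) := by
    rw [MvPolynomial.smul_monomial, smul_eq_mul, mul_one]
  rw [this, map_smul, map_smul, h α ((degree_le_of_mem_support hα).trans hp)]

theorem integrable_eval_and_integral_eq_riesz {y : TMS n d} {ν : Measure (Fin n → ℝ)}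
    (h : IsRepresentingMeasure y ν) {p : MvPolynomial (Fin n) ℝ} (hp : p.totalDegree ≤ d) :
    Integrable (fun x => MvPolynomial.eval x p) ν ∧
      ∫ x, MvPolynomial.eval x p ∂ν = riesz y p := by
  have hI : ∀ α ∈ p.support,
      Integrable (fun x : Fin n → ℝ => p.coeff α * ∏ i, x i ^ α i) ν := fun α hα =>
    ((h ⟨α, (MvPolynomial.degree_le_of_mem_support hα).trans hp⟩).1).const_mul _
  simp only [MvPolynomial.eval_eq']
  refine ⟨integrable_finsetSum _ hI, ?_⟩
  rw [integral_finsetSum _ hI]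
  change _ = rieszLin y p
  conv_rhs => rw [p.as_sum, map_sum]
  refine Finset.sum_congr rfl fun α hα => ?_
  have hα' : α.degree ≤ d := (MvPolynomial.degree_le_of_mem_support hα).trans hp
  have : MvPolynomial.monomial α (p.coeff α) = p.coeff α • MvPolynomial.monomial α (1 : ℝ) := by
    rw [MvPolynomial.smul_monomial, smul_eq_mul, mul_one]
  rw [integral_const_mul, (h ⟨α, hα'⟩).2, this, map_smul, smul_eq_mul]
  congr 1
  exact (riesz_monomial y ⟨α, hα'⟩).symm

end Riesz

/-! ### Multiplication operators and point evaluations -/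

section Decomposition

open MvPolynomial
open scoped InnerProductSpace

variable {σ E : Type*} [Fintype σ] [NormedAddCommGroup E] [InnerProductSpace ℝ E]
  {L : MvPolynomial σ ℝ →ₗ[ℝ] ℝ} {Φ : MvPolynomial σ ℝ →ₗ[ℝ] E} {k j : ℕ}

omit [Fintype σ] in
theorem totalDegree_X_mul_le (i : σ) {p : MvPolynomial σ ℝ} {m : ℕ} (hp : p.totalDegree + 1 ≤ m) :
    (X i * p).totalDegree ≤ m := by
  have h := totalDegree_mul (X i) p
  rw [totalDegree_X] at h
  omega

omit [Fintype σ] in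
/-- The kernel of `Φ` is stable under multiplication by the variables as far as degrees permit. -/
theorem map_X_mul_eq_zero
    (hΦ : ∀ p q, p.totalDegree ≤ k → q.totalDegree ≤ k → ⟪Φ p, Φ q⟫_ℝ = L (p * q))
    (hsurj : ∀ e, ∃ p, p.totalDegree ≤ j ∧ Φ p = e) (hj : j + 1 ≤ k) (i : σ)
    {p : MvPolynomial σ ℝ} (hp : p.totalDegree + 1 ≤ k) (h0 : Φ p = 0) : Φ (X i * p) = 0 := by
  refine ext_inner_right ℝ fun e => ?_
  obtain ⟨q, hq, rfl⟩ := hsurj e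
  -- The variable moves over to `q`, whose degree ≤ `j` leaves room for it.
  rw [inner_zero_left, hΦ _ _ (totalDegree_X_mul_le i hp) (by omega),
    show X i * p * q = p * (X i * q) by ring,
    ← hΦ _ _ (by omega) (totalDegree_X_mul_le i (by omega)), h0, inner_zero_left]

omit [Fintype σ] in
/-- The multiplication operators by the variables: symmetric and commuting. -/
theorem exists_multiplication_operators
    (hΦ : ∀ p q, p.totalDegree ≤ k → q.totalDegree ≤ k → ⟪Φ p, Φ q⟫_ℝ = L (p * q))
    (hsurj : ∀ e, ∃ p, p.totalDegree ≤ j ∧ Φ p = e) (hj : j + 1 ≤ k) :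
    ∃ T : σ → E →ₗ[ℝ] E, (∀ i p, p.totalDegree + 1 ≤ k → T i (Φ p) = Φ (X i * p)) ∧
      (∀ i, (T i).IsSymmetric) ∧ ∀ i i', Commute (T i) (T i') := by
  have hs : LinearMap.range (Φ ∘ₗ (restrictTotalDegree σ ℝ j).subtype) = ⊤ := by
    rw [LinearMap.range_eq_top]
    intro e
    obtain ⟨p, hp, rfl⟩ := hsurj e
    exact ⟨⟨p, (mem_restrictTotalDegree σ j p).2 hp⟩, rfl⟩
  -- A linear choice of low-degree representatives; the kernel lemma makes the operators independent
  -- of it.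
  obtain ⟨s, hs⟩ := LinearMap.exists_rightInverse_of_surjective _ hs
  have hsd (e : E) : (s e).1.totalDegree ≤ j := (mem_restrictTotalDegree σ j _).1 (s e).2
  have hse (e : E) : Φ (s e).1 = e := LinearMap.congr_fun hs e
  let T : σ → E →ₗ[ℝ] E := fun i =>
    Φ ∘ₗ LinearMap.mulLeft ℝ (X i) ∘ₗ (restrictTotalDegree σ ℝ j).subtype ∘ₗ s
  have hT : ∀ i p, p.totalDegree + 1 ≤ k → T i (Φ p) = Φ (X i * p) := by
    intro i p hp
    change Φ (X i * (s (Φ p)).1) = _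
    rw [← sub_eq_zero, ← map_sub, ← mul_sub]
    refine map_X_mul_eq_zero hΦ hsurj hj i ?_ (by rw [map_sub, hse, sub_self])
    have h1 := totalDegree_sub (s (Φ p)).1 p
    have h2 := hsd (Φ p)
    have : max (s (Φ p)).1.totalDegree p.totalDegree ≤ k - 1 := max_le (by omega) (by omega)
    omega
  have hTs : ∀ i, (T i).IsSymmetric := by
    intro i e e'
    obtain ⟨p, hp, rfl⟩ := hsurj e
    obtain ⟨q, hq, rfl⟩ := hsurj e'
    rw [hT i p (by omega), hT i q (by omega), hΦ _ _ (totalDegree_X_mul_le i (by omega)) (by omega),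
      hΦ _ _ (by omega) (totalDegree_X_mul_le i (by omega))]
    congr 1
    ring
  refine ⟨T, hT, hTs, fun i i' => LinearMap.ext fun e => ext_inner_right ℝ fun e' => ?_⟩
  obtain ⟨p, hp, rfl⟩ := hsurj e
  obtain ⟨q, hq, rfl⟩ := hsurj e'
  -- Symmetry puts one variable on each side: applying both to `p` could reach degree `j + 2 > k`.
  rw [Module.End.mul_apply, Module.End.mul_apply, hTs i, hTs i' (T i _),
    hT i p (by omega), hT i q (by omega),
    hT i' p (by omega), hT i' q (by omega),
    hΦ _ _ (totalDegree_X_mul_le i' (by omega)) (totalDegree_X_mul_le i (by omega)),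
    hΦ _ _ (totalDegree_X_mul_le i (by omega)) (totalDegree_X_mul_le i' (by omega))]
  congr 1
  ring

/-- Up to degree `k`, the map `Φ` is a combination of point evaluations with nonzero pairwise
orthogonal coefficients. -/
theorem exists_eval_decomposition [FiniteDimensional ℝ E]
    (hΦ : ∀ p q, p.totalDegree ≤ k → q.totalDegree ≤ k → ⟪Φ p, Φ q⟫_ℝ = L (p * q))
    (hsurj : ∀ e, ∃ p, p.totalDegree ≤ j ∧ Φ p = e) (hj : j + 1 ≤ k) :
    ∃ (S : Finset (σ → ℝ)) (v : (σ → ℝ) → E), (∀ γ ∈ S, v γ ≠ 0) ∧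
      (∀ γ δ, γ ≠ δ → ⟪v γ, v δ⟫_ℝ = 0) ∧
      ∀ p, p.totalDegree ≤ k → Φ p = ∑ γ ∈ S, eval γ p • v γ := by
  obtain ⟨T, hT, hTs, hTc⟩ := exists_multiplication_operators hΦ hsurj hj
  have htop := LinearMap.IsSymmetric.iSup_iInf_eq_top_of_commute hTs (fun i i' _ => hTc i i')
  have h1 : Φ 1 ∈ ⨆ χ : σ → ℝ, ⨅ i, Module.End.eigenspace (T i) (χ i) := htop ▸ Submodule.mem_top
  obtain ⟨f, hf, hsum⟩ := (Submodule.mem_iSup_iff_exists_finsupp _ _).1 h1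
  have hev : ∀ i γ, T i (f γ) = γ i • f γ := fun i γ =>
    Module.End.mem_eigenspace_iff.1 ((Submodule.mem_iInf _).1 (hf γ) i)
  refine ⟨f.support, f, fun γ hγ => Finsupp.mem_support_iff.1 hγ, fun γ δ hγδ => ?_, ?_⟩
  · exact LinearMap.IsSymmetric.orthogonalFamily_iInf_eigenspaces hTs hγδ ⟨f γ, hf γ⟩ ⟨f δ, hf δ⟩
  · let Ψ : MvPolynomial σ ℝ →ₗ[ℝ] E :=
      ∑ γ ∈ f.support, (aeval γ : MvPolynomial σ ℝ →ₐ[ℝ] ℝ).toLinearMap.smulRight (f γ)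
    have hΨ (p : MvPolynomial σ ℝ) : Ψ p = ∑ γ ∈ f.support, eval γ p • f γ := by
      simp [Ψ]
    intro p hp
    rw [← hΨ]
    refine linearMap_eq_of_totalDegree_le (fun α hα => ?_) hp
    clear hp p
    induction hm : α.degree generalizing α with
    | zero =>
      obtain rfl := (Finsupp.degree_eq_zero_iff α).1 hm
      rw [hΨ, show monomial (0 : σ →₀ ℕ) (1 : ℝ) = 1 from rfl, ← hsum]
      simp [Finsupp.sum]
    | succ m ih =>
      obtain ⟨i, hi⟩ : ∃ i, α i ≠ 0 := by
        by_contra! h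
        obtain rfl : α = 0 := Finsupp.ext h
        simp at hm
      obtain ⟨β, rfl⟩ : ∃ β, α = Finsupp.single i 1 + β := by
        refine ⟨α - Finsupp.single i 1, ?_⟩
        rw [add_tsub_cancel_of_le]
        simpa [Nat.one_le_iff_ne_zero] using hi
      rw [map_add, Finsupp.degree_single] at hm hα
      have hX : monomial (Finsupp.single i 1 + β) (1 : ℝ) = X i * monomial β 1 := by
        rw [X, monomial_mul, one_mul]
      rw [hX, ← hT i _ (by rw [totalDegree_monomial_one]; omega), ih β (by omega) (by omega),
        hΨ, hΨ, map_sum]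
      refine Finset.sum_congr rfl fun γ _ => ?_
      rw [map_smul, hev, smul_smul, eval_mul, eval_X, mul_comm]

variable {S : Finset (σ → ℝ)} {v : (σ → ℝ) → E}

/-- Pairing `Φ p` with `v δ` isolates the coefficient `eval δ p`, by orthogonality. So a preimage of
`v γ` is a Lagrange interpolation polynomial at `γ`. -/
theorem eval_eq_ite_of_map_eq (hv : ∀ γ ∈ S, v γ ≠ 0)
    (ho : ∀ γ δ, γ ≠ δ → ⟪v γ, v δ⟫_ℝ = 0)
    (hS : ∀ p, p.totalDegree ≤ k → Φ p = ∑ γ ∈ S, eval γ p • v γ)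
    {p : MvPolynomial σ ℝ} (hp : p.totalDegree ≤ k) {γ : σ → ℝ} (hpγ : Φ p = v γ) :
    ∀ δ ∈ S, eval δ p = if δ = γ then 1 else 0 := by
  classical
  intro δ hδ
  have h : ⟪v δ, Φ p⟫_ℝ = eval δ p * ⟪v δ, v δ⟫_ℝ := by
    rw [hS p hp, inner_sum, Finset.sum_eq_single δ, real_inner_smul_right]
    · intro b _ hb
      rw [real_inner_smul_right, ho _ _ hb.symm, mul_zero]
    · exact fun h => absurd hδ h
  have h0 : ⟪v δ, v δ⟫_ℝ ≠ 0 := inner_self_ne_zero.2 (hv δ hδ)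
  rw [hpγ] at h
  split_ifs with hd
  · subst hd
    exact mul_right_cancel₀ h0 (h.symm.trans (one_mul _).symm)
  · rw [ho _ _ hd] at h
    exact (mul_eq_zero.1 h.symm).resolve_right h0

/-- The points of the decomposition are the common zeros of finitely many elements of the kernel
of `Φ`. -/
theorem exists_finset_forall_eval_eq_zero
    (hv : ∀ γ ∈ S, v γ ≠ 0) (ho : ∀ γ δ, γ ≠ δ → ⟪v γ, v δ⟫_ℝ = 0)
    (hS : ∀ p, p.totalDegree ≤ k → Φ p = ∑ γ ∈ S, eval γ p • v γ)
    (hsurj : ∀ e, ∃ p, p.totalDegree ≤ j ∧ Φ p = e) (hj : j + 1 ≤ k) :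
    ∃ Q : Finset (MvPolynomial σ ℝ), (∀ q ∈ Q, q.totalDegree ≤ k ∧ Φ q = 0) ∧
      ∀ x, (∀ q ∈ Q, eval x q = 0) → x ∈ S := by
  classical
  choose P hPd hP using fun γ => hsurj (v γ)
  have hd (i : σ) (γ : σ → ℝ) : (X i * P γ - γ i • P γ).totalDegree ≤ k :=
    (totalDegree_sub _ _).trans (max_le (totalDegree_X_mul_le i (by have := hPd γ; omega))
      ((totalDegree_smul_le _ _).trans ((hPd γ).trans (by omega))))
  -- Off `S`, the zeros of all (X_i - γ_i) P_γ are zeros of every P_γ, where 1 - ∑ P_γ takes the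
  -- value 1.
  refine ⟨insert (1 - ∑ γ ∈ S, P γ)
    ((Finset.univ ×ˢ S).image fun a => X a.1 * P a.2 - a.2 a.1 • P a.2), ?_, fun x hx => ?_⟩
  · simp only [Finset.forall_mem_insert, Finset.forall_mem_image]
    refine ⟨⟨?_, ?_⟩, fun a ha => ⟨hd a.1 a.2, ?_⟩⟩
    · refine (totalDegree_sub _ _).trans (max_le (by simp) ?_)
      exact totalDegree_finsetSum_le fun γ _ => (hPd γ).trans (by omega)
    · rw [map_sub, map_sum, hS 1 (by simp), Finset.sum_congr rfl fun γ _ => hP γ]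
      simp
    · rw [hS _ (hd a.1 a.2)]
      refine Finset.sum_eq_zero fun δ hδ => ?_
      simp only [eval_sub, eval_mul, eval_X, smul_eval,
        eval_eq_ite_of_map_eq hv ho hS ((hPd a.2).trans (by omega)) (hP a.2) δ hδ]
      split_ifs with h
      · simp [h]
      · simp
  · simp only [Finset.forall_mem_insert, Finset.forall_mem_image] at hx
    obtain ⟨hx1, hx2⟩ := hx
    by_contra hxS
    have hPx : ∀ γ ∈ S, eval x (P γ) = 0 := by
      intro γ hγ
      obtain ⟨i, hi⟩ := Function.ne_iff.1 (show x ≠ γ from fun h => hxS (h ▸ hγ))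
      have h := hx2 (Finset.mk_mem_product (Finset.mem_univ i) hγ)
      simp only [eval_sub, eval_mul, eval_X, smul_eval, ← sub_mul] at h
      exact (mul_eq_zero.1 h).resolve_left (sub_ne_zero.2 hi)
    rw [eval_sub, eval_sum, Finset.sum_eq_zero hPx] at hx1
    simp at hx1

omit [Fintype σ] in
/-- Up to degree `2k`, the functional `L` is the sum of the point evaluations with weights
`‖v γ‖²`. -/
theorem linearMap_eq_sum_norm_sq_mul_eval
    (hΦ : ∀ p q, p.totalDegree ≤ k → q.totalDegree ≤ k → ⟪Φ p, Φ q⟫_ℝ = L (p * q))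
    (ho : ∀ γ δ, γ ≠ δ → ⟪v γ, v δ⟫_ℝ = 0)
    (hS : ∀ p, p.totalDegree ≤ k → Φ p = ∑ γ ∈ S, eval γ p • v γ)
    {p : MvPolynomial σ ℝ} (hp : p.totalDegree ≤ 2 * k) :
    L p = ∑ γ ∈ S, ‖v γ‖ ^ 2 * eval γ p := by
  let Λ : MvPolynomial σ ℝ →ₗ[ℝ] ℝ :=
    ∑ γ ∈ S, (‖v γ‖ ^ 2) • (aeval γ : MvPolynomial σ ℝ →ₐ[ℝ] ℝ).toLinearMap
  have hΛ (p : MvPolynomial σ ℝ) : Λ p = ∑ γ ∈ S, ‖v γ‖ ^ 2 * eval γ p := by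
    simp [Λ]
  rw [← hΛ]
  refine linearMap_eq_of_totalDegree_le (fun α hα => ?_) hp
  -- A monomial of degree ≤ 2k is a product of two of degree ≤ k, to which `hΦ` applies.
  obtain ⟨β, β', hβ, hβ', rfl⟩ : ∃ β β' : σ →₀ ℕ, β.degree ≤ k ∧ β'.degree ≤ k ∧ α = β + β' := by
    rcases le_total α.degree k with h | h
    · exact ⟨α, 0, h, by simp, by simp⟩
    · obtain ⟨β, hβα, hβ⟩ := Finsupp.exists_le_degree_eq α k h
      obtain ⟨β', rfl⟩ := exists_add_of_le hβα
      rw [map_add] at hα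
      exact ⟨β, β', hβ.le, by omega, rfl⟩
  have hm : monomial (β + β') (1 : ℝ) = monomial β 1 * monomial β' 1 := by
    rw [monomial_mul, one_mul]
  have hd : (monomial β (1 : ℝ)).totalDegree ≤ k := by rwa [totalDegree_monomial_one]
  have hd' : (monomial β' (1 : ℝ)).totalDegree ≤ k := by rwa [totalDegree_monomial_one]
  rw [hΛ, hm, ← hΦ _ _ hd hd', hS _ hd, hS _ hd', sum_inner]
  refine Finset.sum_congr rfl fun γ hγ => ?_
  rw [inner_sum, Finset.sum_eq_single γ]
  · rw [real_inner_smul_left, real_inner_smul_right, real_inner_self_eq_norm_sq, eval_mul]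
    ring
  · intro δ _ hδ
    rw [real_inner_smul_left, real_inner_smul_right, ho _ _ hδ.symm, mul_zero, mul_zero]
  · exact fun h => absurd hγ h

-- The `v γ` are independent, being nonzero and orthogonal, and they span because `Φ` is onto.
omit [Fintype σ] in
theorem card_eq_finrank [FiniteDimensional ℝ E]
    (hv : ∀ γ ∈ S, v γ ≠ 0) (ho : ∀ γ δ, γ ≠ δ → ⟪v γ, v δ⟫_ℝ = 0)
    (hS : ∀ p, p.totalDegree ≤ k → Φ p = ∑ γ ∈ S, eval γ p • v γ)
    (hsurj : ∀ e, ∃ p, p.totalDegree ≤ k ∧ Φ p = e) : S.card = Module.finrank ℝ E := by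
  have hli : LinearIndependent ℝ (fun γ : S => v γ) :=
    linearIndependent_of_ne_zero_of_inner_eq_zero (fun γ => hv γ γ.2)
      fun γ δ h => ho _ _ (fun h' => h (Subtype.ext h'))
  have hsp : ⊤ ≤ Submodule.span ℝ (Set.range fun γ : S => v γ) := by
    intro e _
    obtain ⟨p, hp, rfl⟩ := hsurj e
    rw [hS p hp]
    exact Submodule.sum_mem _ fun γ hγ =>
      Submodule.smul_mem _ _ (Submodule.subset_span ⟨⟨γ, hγ⟩, rfl⟩)
  rw [Module.finrank_eq_card_basis (Module.Basis.mk hli hsp), Fintype.card_coe]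

end Decomposition

/-! ### Representing measures and atomic measures -/

section Representation

open MvPolynomial
open scoped InnerProductSpace

variable {n k : ℕ}

theorem eq_sum_locExpo_monomial {e : ℕ} {p : MvPolynomial (Fin n) ℝ}
    (hp : 2 * p.totalDegree + e ≤ 2 * k) :
    p = ∑ α : LocExpo n k e, p.coeff α.1 • monomial α.1 1 := by
  classical
  ext β
  simp only [coeff_sum, coeff_smul, coeff_monomial, smul_eq_mul]
  by_cases hβ : 2 * β.degree + e ≤ 2 * k
  · rw [Finset.sum_eq_single ⟨β, hβ⟩]
    · simp
    · intro α _ h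
      rw [if_neg (fun h' => h (Subtype.ext h')), mul_zero]
    · simp
  · rw [Finset.sum_eq_zero]
    · by_contra h
      have := degree_le_of_mem_support (mem_support_iff.2 h)
      omega
    · rintro ⟨α, hα⟩ _
      rw [if_neg, mul_zero]
      rintro rfl
      exact hβ hα

/-- A flat moment matrix is the Gram matrix, with respect to the monomials, of a linear map to a
Euclidean space of dimension its rank, onto which the polynomials of low degree already map. -/
theorem exists_gram_map {y : TMS n (2 * k)} {j : ℕ} (hj : j ≤ k)
    (hpsd : (momentMatrix y k).PosSemidef)
    (hrank : (momentMatrix y j).rank = (momentMatrix y k).rank) :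
    ∃ Φ : MvPolynomial (Fin n) ℝ →ₗ[ℝ] EuclideanSpace ℝ (Fin (momentMatrix y k).rank),
      (∀ p q, p.totalDegree ≤ k → q.totalDegree ≤ k → ⟪Φ p, Φ q⟫_ℝ = rieszLin y (p * q)) ∧
      ∀ e, ∃ p, p.totalDegree ≤ j ∧ Φ p = e := by
  let f : LocExpo n j 0 → LocExpo n k 0 := fun α => ⟨α.1, by have := α.2; omega⟩
  -- `hrank` fits because M_j(y) is by definition the submatrix of M_k(y) along `f`.
  obtain ⟨u, hu, hspan⟩ := hpsd.exists_gram_rank f hrank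
  let Φ : MvPolynomial (Fin n) ℝ →ₗ[ℝ] EuclideanSpace ℝ (Fin (momentMatrix y k).rank) :=
    ∑ α : LocExpo n k 0, (lcoeff ℝ α.1).smulRight (u α)
  have hΦ (p) : Φ p = ∑ α : LocExpo n k 0, p.coeff α.1 • u α := by
    simp [Φ]
  refine ⟨Φ, fun p q hp hq => ?_, fun e => ?_⟩
  · conv_rhs => rw [eq_sum_locExpo_monomial (k := k) (e := 0) (p := p) (by omega),
      eq_sum_locExpo_monomial (k := k) (e := 0) (p := q) (by omega)]
    rw [hΦ, hΦ, Finset.sum_mul_sum, sum_inner, map_sum]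
    refine Finset.sum_congr rfl fun α _ => ?_
    rw [inner_sum, map_sum]
    refine Finset.sum_congr rfl fun β _ => ?_
    rw [real_inner_smul_left, real_inner_smul_right, hu, smul_mul_smul_comm, map_smul, smul_eq_mul,
      mul_assoc]
    rw [momentMatrix, locMatrix, Matrix.of_apply, one_mul]
    rfl
  · have he : e ∈ Submodule.span ℝ (Set.range (u ∘ f)) := hspan ▸ Submodule.mem_top
    obtain ⟨c, rfl⟩ := (Submodule.mem_span_range_iff_exists_fun ℝ).1 he
    refine ⟨∑ α, c α • monomial α.1 1, ?_, ?_⟩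
    · refine totalDegree_finsetSum_le fun α _ => (totalDegree_smul_le _ _).trans ?_
      rw [totalDegree_monomial_one]
      have := α.2
      omega
    · rw [map_sum]
      refine Finset.sum_congr rfl fun α _ => ?_
      rw [map_smul, hΦ, Finset.sum_eq_single (f α)]
      · simp [f]
      · intro β _ h
        rw [coeff_monomial, if_neg (fun h' => h (Subtype.ext h'.symm)), zero_smul]
      · simp

theorem isFiniteMeasure_of_isRepresentingMeasure {d : ℕ} {y : TMS n d} {ν : Measure (Fin n → ℝ)}
    (h : IsRepresentingMeasure y ν) : IsFiniteMeasure ν := by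
  have := (h ⟨0, by simp⟩).1
  simpa [integrable_const_iff] using this

/-- A representing measure lives on the common zeros of the polynomials `p` with `𝓛_y(p²) = 0`. -/
theorem ae_eval_eq_zero {y : TMS n (2 * k)} {ν : Measure (Fin n → ℝ)}
    (h : IsRepresentingMeasure y ν) {p : MvPolynomial (Fin n) ℝ} (hp : p.totalDegree ≤ k)
    (h0 : riesz y (p * p) = 0) : ∀ᵐ x ∂ν, eval x p = 0 := by
  have hd : (p * p).totalDegree ≤ 2 * k := (totalDegree_mul p p).trans (by omega)
  obtain ⟨h1, h2⟩ := integrable_eval_and_integral_eq_riesz h hd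
  rw [h0, integral_eq_zero_iff_of_nonneg _ h1] at h2
  · filter_upwards [h2] with x hx
    simpa using hx
  · intro x
    simpa using mul_self_nonneg (eval x p)

/-- The finite measure with atoms `γ ∈ S` of mass `w γ`. -/
noncomputable def atomicMeasure (S : Finset (Fin n → ℝ)) (w : (Fin n → ℝ) → ℝ) :
    Measure (Fin n → ℝ) :=
  ∑ γ ∈ S, ENNReal.ofReal (w γ) • Measure.dirac γ

variable {S : Finset (Fin n → ℝ)} {w : (Fin n → ℝ) → ℝ}

theorem integrable_atomicMeasure (f : (Fin n → ℝ) → ℝ) : Integrable f (atomicMeasure S w) := by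
  refine integrable_finsetSum_measure.2 fun γ _ => Integrable.smul_measure ?_ ENNReal.ofReal_ne_top
  exact integrable_dirac (by simp)

theorem integral_atomicMeasure (hw : ∀ γ ∈ S, 0 ≤ w γ) (f : (Fin n → ℝ) → ℝ) :
    ∫ x, f x ∂atomicMeasure S w = ∑ γ ∈ S, w γ * f γ := by
  rw [atomicMeasure, integral_finsetSum_measure fun γ _ =>
    Integrable.smul_measure (integrable_dirac (by simp)) ENNReal.ofReal_ne_top]
  refine Finset.sum_congr rfl fun γ hγ => ?_
  rw [integral_smul_measure, integral_dirac, ENNReal.toReal_ofReal (hw γ hγ), smul_eq_mul]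

theorem support_atomicMeasure (hw : ∀ γ ∈ S, 0 < w γ) : (atomicMeasure S w).support = S := by
  apply Set.Subset.antisymm
  · refine Measure.support_subset_of_isClosed S.finite_toSet.isClosed ?_
    rw [mem_ae_iff, atomicMeasure, Measure.finsetSum_apply]
    refine Finset.sum_eq_zero fun γ hγ => ?_
    rw [Measure.smul_apply, Measure.dirac_apply]
    simp [Set.indicator, hγ]
  · intro γ hγ
    rw [Measure.mem_support_iff_forall]
    intro U hU
    have hγU : γ ∈ U := mem_of_mem_nhds hU
    rw [atomicMeasure, Measure.finsetSum_apply]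
    refine lt_of_lt_of_le ?_ (Finset.single_le_sum (fun _ _ => zero_le) hγ)
    rw [Measure.smul_apply, Measure.dirac_apply_of_mem hγU, smul_eq_mul, mul_one]
    exact ENNReal.ofReal_pos.2 (hw γ hγ)

/-- The mass of an atom is the integral of any function which is its indicator on the carrier `S`. -/
theorem measureReal_singleton_eq_integral {ν : Measure (Fin n → ℝ)}
    (hS : ∀ᵐ x ∂ν, x ∈ S) {γ : Fin n → ℝ} {f : (Fin n → ℝ) → ℝ}
    (hf : ∀ δ ∈ S, f δ = if δ = γ then 1 else 0) :
    ν.real {γ} = ∫ x, f x ∂ν := by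
  rw [← integral_indicator_one (measurableSet_singleton γ)]
  refine integral_congr_ae ?_
  filter_upwards [hS] with x hx
  rw [hf x hx]
  simp [Set.indicator]

theorem measure_eq_of_ae_mem_finset {μ ν : Measure (Fin n → ℝ)} [IsFiniteMeasure μ]
    [IsFiniteMeasure ν] (hμ : ∀ᵐ x ∂μ, x ∈ S) (hν : ∀ᵐ x ∂ν, x ∈ S)
    (h : ∀ γ ∈ S, μ.real {γ} = ν.real {γ}) : μ = ν := by
  have key {ρ : Measure (Fin n → ℝ)} (hρ : ∀ᵐ x ∂ρ, x ∈ S) (A : Set (Fin n → ℝ))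
      [DecidablePred (· ∈ A)] :
      ρ A = ∑ γ ∈ S with γ ∈ A, ρ {γ} := by
    rw [sum_measure_singleton]
    refine measure_congr ?_
    filter_upwards [hρ] with x hx
    exact propext ⟨fun h => Finset.mem_filter.2 ⟨hx, h⟩,
      fun h => (Finset.mem_filter.1 h).2⟩
  classical
  ext A _
  rw [key hμ, key hν]
  refine Finset.sum_congr rfl fun γ hγ => ?_
  exact (measureReal_eq_measureReal_iff).1 (h γ (Finset.mem_filter.1 hγ).1)

end Representation

/-! ### Localizing matrices and the main theorem -/

/-- Since D ≤ 2 d_H, polynomials of degree ≤ k - d_H, such as the P_γ, may be tested in the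
localizing matrix. -/
theorem two_mul_sub_halfDegree_add_le {n k l : ℕ}
    {H : Matrix (Fin l) (Fin l) (MvPolynomial (Fin n) ℝ)} (hle : halfDegree H ≤ k) :
    2 * (k - halfDegree H) + entryDegree H ≤ 2 * k := by
  have : entryDegree H ≤ 2 * halfDegree H := by
    refine Finset.sup_le fun ij _ => ?_
    have h1 := Finset.le_sup (f := fun ij : Fin l × Fin l => ((H ij.1 ij.2).totalDegree + 1) / 2)
      (Finset.mem_univ ij)
    change ((H ij.1 ij.2).totalDegree + 1) / 2 ≤ _ at h1
    have h2 := le_max_right 1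
      (Finset.univ.sup fun ij : Fin l × Fin l => ((H ij.1 ij.2).totalDegree + 1) / 2)
    change _ ≤ halfDegree H at h2
    omega
  omega

open MvPolynomial in
/-- The quadratic form of the localizing matrix at the coefficient vectors of `c i • p`. -/
theorem riesz_sum_mul_nonneg {n k l d : ℕ} {y : TMS n d}
    {H : Matrix (Fin l) (Fin l) (MvPolynomial (Fin n) ℝ)} (hpsd : (blockLocMatrix y H k).PosSemidef)
    {p : MvPolynomial (Fin n) ℝ} (hp : 2 * p.totalDegree + entryDegree H ≤ 2 * k) (c : Fin l → ℝ) :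
    0 ≤ rieszLin y (∑ i, ∑ j, (c i * c j) • (H i j * p * p)) := by
  have hpe := eq_sum_locExpo_monomial hp
  have h := hpsd.dotProduct_mulVec_nonneg (fun a => c a.1 * p.coeff a.2.1)
  refine h.trans_eq ?_
  simp only [dotProduct, Matrix.mulVec, Fintype.sum_prod_type, Pi.star_apply, star_trivial, map_sum,
    map_smul, smul_eq_mul, Finset.mul_sum]
  refine Finset.sum_congr rfl fun i _ => ?_
  rw [Finset.sum_comm]
  refine Finset.sum_congr rfl fun j _ => ?_
  conv_rhs => rw [mul_assoc (H i j), hpe]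
  rw [Finset.sum_mul_sum, Finset.mul_sum, map_sum, Finset.mul_sum]
  refine Finset.sum_congr rfl fun α _ => ?_
  rw [Finset.mul_sum, map_sum, Finset.mul_sum]
  refine Finset.sum_congr rfl fun β _ => ?_
  rw [smul_mul_smul_comm, mul_smul_comm, map_smul, smul_eq_mul, ← mul_assoc (H i j)]
  simp only [blockLocMatrix, locMatrix, Matrix.of_apply, rieszLin_apply]
  ring

open MvPolynomial in
theorem proposition2p1 {n k l : ℕ} (y : TMS n (2 * k))
    (H : Matrix (Fin l) (Fin l) (MvPolynomial (Fin n) ℝ)) (hH : H.IsSymm) (hflat : IsFlat y H) :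
    ∃ μ : Measure (Fin n → ℝ),
      IsRepresentingMeasure y μ ∧
      (∀ ν : Measure (Fin n → ℝ), IsRepresentingMeasure y ν → ν = μ) ∧
      IsAtomicOfCard μ (momentMatrix y k).rank ∧
      μ.support ⊆ psdSet H := by
  obtain ⟨hle, hmom, hloc, hrank⟩ := hflat
  have hd1 : 1 ≤ halfDegree H := le_max_left _ _
  have hdeg := two_mul_sub_halfDegree_add_le hle
  set j := k - halfDegree H with hj
  have hjk : j + 1 ≤ k := by omega
  obtain ⟨Φ, hΦ, hsurj⟩ := exists_gram_map (by omega) hmom hrank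
  obtain ⟨S, v, hv, ho, hS⟩ := exists_eval_decomposition hΦ hsurj hjk
  have hsum {p : MvPolynomial (Fin n) ℝ} (hp : p.totalDegree ≤ 2 * k) :=
    linearMap_eq_sum_norm_sq_mul_eval hΦ ho hS hp
  have hw : ∀ γ ∈ S, 0 < ‖v γ‖ ^ 2 := fun γ hγ => pow_pos (norm_pos_iff.2 (hv γ hγ)) 2
  let μ := atomicMeasure S fun γ => ‖v γ‖ ^ 2
  have hμ : IsRepresentingMeasure y μ := by
    refine fun α => ⟨integrable_atomicMeasure _, ?_⟩
    rw [integral_atomicMeasure fun γ hγ => (hw γ hγ).le, ← riesz_monomial y α]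
    change _ = rieszLin y _
    rw [hsum (by rw [totalDegree_monomial_one]; exact α.2)]
    refine Finset.sum_congr rfl fun γ _ => ?_
    rw [eval_monomial, one_mul, Finsupp.prod_fintype _ _ fun i => pow_zero _]
  choose P hPd hP using fun γ => hsurj (v γ)
  have hPS γ := eval_eq_ite_of_map_eq hv ho hS ((hPd γ).trans (by omega)) (hP γ)
  have hae {ν : Measure (Fin n → ℝ)} (hν : IsRepresentingMeasure y ν) : ∀ᵐ x ∂ν, x ∈ S := by
    obtain ⟨Q, hQ, hQS⟩ := exists_finset_forall_eval_eq_zero hv ho hS hsurj hjk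
    have h : ∀ᵐ x ∂ν, ∀ q ∈ Q, eval x q = 0 := by
      refine (ae_ball_iff Q.countable_toSet).2 fun q hq => ?_
      obtain ⟨hqd, hq0⟩ := hQ q hq
      refine ae_eval_eq_zero hν hqd ?_
      change rieszLin y _ = 0
      rw [← hΦ q q hqd hqd, hq0, inner_zero_left]
    exact h.mono hQS
  have hsupp : μ.support = S := support_atomicMeasure hw
  refine ⟨μ, hμ, fun ν hν => ?_, ?_, ?_⟩
  · have := isFiniteMeasure_of_isRepresentingMeasure hμ
    have := isFiniteMeasure_of_isRepresentingMeasure hν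
    refine measure_eq_of_ae_mem_finset (hae hν) (hae hμ) fun γ hγ => ?_
    have hd : (P γ).totalDegree ≤ 2 * k := (hPd γ).trans (by omega)
    -- Both masses of `γ` equal 𝓛(P_γ), which depends on `y` alone.
    rw [measureReal_singleton_eq_integral (hae hν) (hPS γ),
      measureReal_singleton_eq_integral (hae hμ) (hPS γ),
      (integrable_eval_and_integral_eq_riesz hν hd).2,
      (integrable_eval_and_integral_eq_riesz hμ hd).2]
  · have hcard := card_eq_finrank hv ho hS fun e =>
      (hsurj e).imp fun p hp => ⟨hp.1.trans (by omega), hp.2⟩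
    rw [finrank_euclideanSpace_fin] at hcard
    rw [IsAtomicOfCard, hsupp, Set.encard_coe_eq_coe_finsetCard, hcard]
  · rw [hsupp]
    intro γ hγ
    refine Matrix.PosSemidef.of_dotProduct_mulVec_nonneg ?_ fun c => ?_
    · ext i i'
      simp [hH.apply i i']
    · have h := riesz_sum_mul_nonneg hloc (p := P γ) (by have := hPd γ; omega) c
      -- P_γ vanishes at the other atoms, so only the term cᵀH(γ)c with its positive weight
      -- survives.
      rw [hsum, Finset.sum_eq_single γ] at h
      · have h' := nonneg_of_mul_nonneg_right h (hw γ hγ)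
        refine h'.trans_eq ?_
        simp only [eval_sum, smul_eval, eval_mul, hPS γ γ hγ, if_true, mul_one, dotProduct,
          Matrix.mulVec, Matrix.map_apply, Finset.mul_sum, star_trivial, Pi.star_apply]
        refine Finset.sum_congr rfl fun i _ => Finset.sum_congr rfl fun i' _ => ?_
        ring
      · intro δ hδ hne
        simp [hPS γ δ hδ, hne]
      · exact fun h => absurd hγ h
      · refine totalDegree_finsetSum_le fun i _ => totalDegree_finsetSum_le fun i' _ =>
          (totalDegree_smul_le _ _).trans ?_
        have h1 := totalDegree_mul (H i i' * P γ) (P γ)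
        have h2 := totalDegree_mul (H i i') (P γ)
        have h3 : (H i i').totalDegree ≤ entryDegree H :=
          Finset.le_sup (f := fun ij : Fin l × Fin l => (H ij.1 ij.2).totalDegree)
            (Finset.mem_univ (i, i'))
        have h4 := hPd γ
        omega
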